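/- Let $f\in\mathbb{C}[x,y]$ be a nonconstant polynomial. Identify morphisms $\mathbb{A}^2\to\mathbb{A}^1$ and $\mathbb{A}^1\to\mathbb{A}^1$ over $\mathbb{C}$ with polynomials in $\mathbb{C}[x,y]$ and $\mathbb{C}[z]$ respectively. A factorization of $f$ is a pair $(\alpha,j)$ with $\alpha\in\mathbb{C}[z]$, $j\in\mathbb{C}[x,y]$ and $f=\alpha\circ j=\alpha(j)$; its depth is $\deg\alpha$, and it is deepest if no factorization of $f$ has larger depth. Two factorizations $(\alpha_1,j_1)$ and $(\alpha_2,j_2)$ of $f$ are equivalent if there is an isomorphism $i:\mathbb{A}^1\to\mathbb{A}^1$ with $\alpha_2=\alpha_1\circ i$ and $j_1=i\circ j_2$. A factorization $(\alpha_0,j_0)$ of $f$ is universal if for every factorization $(\alpha,j)$ of $f$ there is a morphism $i:\mathbb{A}^1\to\mathbb{A}^1$ with $\alpha_0=\alpha\circ i$ and $j=i\circ j_0$. Let $\mathbb{T}\subseteq\mathbb{C}[z]$ be the set of monic polynomials $z^k+e_{k-1}z^{k-1}+\cdots+e_0$ with $k\ge 1$ and $e_{k-1}=0$. For $g\in\mathbb{C}[x,y]$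 let $\mathcal{W}(g)=\{W\in\mathbb{C}[x,y] : g=\alpha(W)\text{ for some }\alpha\in\mathbb{T}\}$, and call $g$ principal if $\mathcal{W}(g)=\{g\}$. Then: 1. $f$ has a universal factorization, and any two universal factorizations of $f$ are equivalent. 2. A factorization of $f$ is universal if and only if it is deepest. 3. $\mathcal{W}(f)$ contains a principal polynomial, unique up to multiplication by roots of unity. More precisely, there are $\alpha_0\in\mathbb{T}$ and a principal polynomial $W_0\in\mathcal{W}(f)$ such that $(\alpha_0,W_0)$ is a universal factorization of $f$, and the principal polynomials in $\mathcal{W}(f)$ are exactly the polynomials $\zeta W_0$ with $\zeta\in\mathbb{C}$, $\zeta^{\deg\alpha_0}=1$. -/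

import Mathlib

open Polynomial

/-- The ring `ℂ[x, y]`. Its elements are also regarded as the morphisms `𝔸² → 𝔸¹` over `ℂ`, and
elements of `ℂ[X]` as the morphisms `𝔸¹ → 𝔸¹`; composition of morphisms is substitution. -/
abbrev PlaneRing : Type := MvPolynomial (Fin 2) ℂ

/-- The substitution `α(W)`, i.e. the composite morphism `α ∘ W : 𝔸² → 𝔸¹ → 𝔸¹`. -/
noncomputable def substPoly (α : ℂ[X]) (W : PlaneRing) : PlaneRing := Polynomial.aeval W α

/-- `f` is not a constant polynomial. -/
def IsNonconstant (f : PlaneRing) : Prop := ∀ c : ℂ, f ≠ MvPolynomial.C c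

/-- A factorization `f = α ∘ j` with `j : 𝔸² → 𝔸¹` and `α : 𝔸¹ → 𝔸¹`. -/
structure LineFactorization (f : PlaneRing) where
  /-- the morphism `α` -/
  outer : ℂ[X]
  /-- the morphism `j` -/
  inner : PlaneRing
  /-- `f = α ∘ j` -/
  fac : f = substPoly outer inner

namespace LineFactorization

variable {f : PlaneRing}

/-- The depth of `f = α ∘ j` is the degree of `α`. -/
noncomputable def depth (F : LineFactorization f) : ℕ := F.outer.natDegree

/-- No factorization of `f` has larger depth. -/
def IsDeepest (F : LineFactorization f) : Prop := ∀ G : LineFactorization f, G.depth ≤ F.depth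

/-- `f = α₀ ∘ j₀` is universal: for every factorization `f = α ∘ j` there is a morphism
`i : 𝔸¹ → 𝔸¹` with `α₀ = α ∘ i` and `j = i ∘ j₀`. -/
def IsUniversal (F : LineFactorization f) : Prop :=
  ∀ G : LineFactorization f, ∃ i : ℂ[X],
    F.outer = G.outer.comp i ∧ G.inner = substPoly i F.inner

end LineFactorization

/-- The polynomial `i` is an isomorphism `𝔸¹ → 𝔸¹`. -/
def IsLineIso (i : ℂ[X]) : Prop := ∃ i' : ℂ[X], i.comp i' = X ∧ i'.comp i = X

/-- `f = α₁ ∘ j₁` and `f = α₂ ∘ j₂` are equivalent: there is an isomorphism `i : 𝔸¹ → 𝔸¹` with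
`α₂ = α₁ ∘ i` and `j₁ = i ∘ j₂`. -/
def LineFactorization.Equivalent {f : PlaneRing} (F₁ F₂ : LineFactorization f) : Prop :=
  ∃ i : ℂ[X], IsLineIso i ∧ F₂.outer = F₁.outer.comp i ∧ F₁.inner = substPoly i F₂.inner

/-- Tschirnhausen polynomials: `z^k + e_{k-1} z^{k-1} + ⋯ + e_0` with `k > 0` and `e_{k-1} = 0`. -/
def tschirnhausen : Set ℂ[X] :=
  {α | α.Monic ∧ 0 < α.natDegree ∧ α.coeff (α.natDegree - 1) = 0}

/-- `𝒲(f)`, the set of all `W` such that `f = α(W)` for some Tschirnhausen polynomial `α`. -/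
def tschirnhausenRoots (f : PlaneRing) : Set PlaneRing :=
  {W | ∃ α ∈ tschirnhausen, f = substPoly α W}

/-- `f` is principal if `𝒲(f) = {f}`. -/
def IsPrincipalPoly (f : PlaneRing) : Prop := tschirnhausenRoots f = {f}

/-! Whenever `f = α(j)`, the polynomial `j` is integral over `ℂ[f]`, so every inner factor lies in
the integral closure `A` of `ℂ[f]` in `ℂ[x, y]`. The key fact is `A = ℂ[j₀]`; then `j₀` is the inner
part of a universal factorization (`exists_generator_integralClosure`). Restriction to a line where
`f` is nonconstant embeds `A` into `ℂ[X]`. By Lüroth, the field generated by the image is `ℂ(u)`,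
with `u` a polynomial (`exists_polynomial_generator`). As `A` is integrally closed, `u` comes from
`A`, and `ℂ(u) ∩ ℂ[X] = ℂ[u]` (`mem_adjoin_polynomial`). The rest is degree counting: depth is
multiplicative under composition, so deepest means universal up to a linear substitution. A linear
substitution makes the outer part Tschirnhausen, and only roots of unity preserve that form. -/

/-! ### Integrality and Lüroth's theorem for polynomials -/

/-- If `α(x)` is integral over `A` for a nonconstant polynomial `α` over a field contained in `A`,
then so is `x`. -/
theorem IsIntegral.of_aeval_natDegree_pos {K A B : Type*} [Field K] [CommRing A] [CommRing B]
    [Algebra K A] [Algebra A B] [Algebra K B] [IsScalarTower K A B] (α : K[X])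
    (hα : 0 < α.natDegree) (x : B) (h : IsIntegral A (aeval x α)) : IsIntegral A x := by
  rcases subsingleton_or_nontrivial A with hA | hA
  · have := Module.subsingleton A B
    rw [Subsingleton.elim x 0]
    exact isIntegral_zero
  have hα0 : α.leadingCoeff ≠ 0 := by
    rw [Ne, leadingCoeff_eq_zero]
    rintro rfl
    simp at hα
  have hm : (C α.leadingCoeff⁻¹ * α).Monic := by
    rw [Monic, leadingCoeff_mul, leadingCoeff_C, inv_mul_cancel₀ hα0]
  refine IsIntegral.of_aeval_monic (hm.map (algebraMap K A)) ?_ ?_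
  · rw [hm.natDegree_map, natDegree_C_mul (inv_ne_zero hα0)]
    exact hα.ne'
  · rw [aeval_map_algebraMap, map_mul, aeval_C, IsScalarTower.algebraMap_apply K A B]
    exact isIntegral_algebraMap.mul h

/-- A `K`-algebra map to `K[X]` whose image contains a nonconstant polynomial is integral. -/
theorem isIntegral_polynomial_of_natDegree_pos {K A : Type*} [Field K] [CommRing A] [Algebra K A]
    (σ : A →ₐ[K] K[X]) (a : A) (ha : 0 < (σ a).natDegree) (q : K[X]) :
    σ.toRingHom.IsIntegralElem q := by
  let _ := σ.toRingHom.toAlgebra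
  have : IsScalarTower K A K[X] := .of_algebraMap_eq fun c => (σ.commutes c).symm
  have hX : IsIntegral A (X : K[X]) := by
    refine .of_aeval_natDegree_pos (σ a) ha _ ?_
    rw [aeval_X_left_apply]
    exact isIntegral_algebraMap (x := a)
  change IsIntegral A q
  induction q using Polynomial.induction_on' with
  | add p q hp hq => exact hp.add hq
  | monomial n c =>
    rw [← C_mul_X_pow_eq_monomial, ← algebraMap_eq, IsScalarTower.algebraMap_apply K A K[X]]
    exact isIntegral_algebraMap.mul (hX.pow n)

theorem luroth_generator_eq_coeff {K : Type*} [Field K] (E : IntermediateField K (RatFunc K)) :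
    ∃ i, RatFunc.Luroth.generator E = 0 ∨
      RatFunc.Luroth.generator E = ((minpoly E (RatFunc.X : RatFunc K)).coeff i : RatFunc K) := by
  unfold RatFunc.Luroth.generator
  split_ifs with h
  · exact ⟨0, .inl rfl⟩
  · exact ⟨_, .inr rfl⟩

/-- Lüroth's theorem for fields containing a nonconstant polynomial: the generator may be chosen
to be a polynomial. -/
theorem exists_polynomial_generator {K : Type*} [Field K] (E : IntermediateField K (RatFunc K))
    (p : K[X]) (hp : 0 < p.natDegree) (hpE : algebraMap K[X] (RatFunc K) p ∈ E) :
    ∃ u : K[X], E = IntermediateField.adjoin K {algebraMap K[X] (RatFunc K) u} := by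
  obtain ⟨i, hi⟩ := luroth_generator_eq_coeff E
  suffices h : ∃ u, algebraMap K[X] (RatFunc K) u = RatFunc.Luroth.generator E by
    obtain ⟨u, hu⟩ := h
    exact ⟨u, hu ▸ RatFunc.Luroth.eq_adjoin_generator⟩
  rcases hi with hi | hi
  · exact ⟨0, by rw [hi, map_zero]⟩
  obtain ⟨q, hqm, hq⟩ := isIntegral_polynomial_of_natDegree_pos (aeval p) (X : K[X])
    (by rwa [aeval_X]) (X : K[X])
  let τ : K[X] →ₐ[K] E := aeval ⟨_, hpE⟩
  have hτ : (algebraMap E (RatFunc K)).comp τ.toRingHom =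
      (algebraMap K[X] (RatFunc K)).comp (aeval p : K[X] →ₐ[K] K[X]).toRingHom := by
    have : (E.val.comp τ) = ((Algebra.ofId K[X] (RatFunc K)).restrictScalars K).comp
        (aeval p : K[X] →ₐ[K] K[X]) := by
      ext1
      simp [τ, Algebra.ofId_apply]
    exact congrArg AlgHom.toRingHom this
  -- A monic factor of a monic polynomial over `K[p]` has coefficients integral over `K[p]`, hence
  -- over `K[X]`; being integral rational functions, they are polynomials.
  have hdvd : minpoly E (RatFunc.X : RatFunc K) ∣ q.map τ.toRingHom := by
    refine minpoly.dvd _ _ ?_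
    rw [aeval_def, eval₂_map, hτ, ← RatFunc.algebraMap_X, ← hom_eval₂, hq, map_zero]
  have hmon : (minpoly E (RatFunc.X : RatFunc K)).Monic :=
    minpoly.monic ⟨q.map τ.toRingHom, hqm.map _, by
      rw [eval₂_map, hτ, ← RatFunc.algebraMap_X, ← hom_eval₂, hq, map_zero]⟩
  have hint : τ.toRingHom.IsIntegralElem ((minpoly E (RatFunc.X : RatFunc K)).coeff i) := by
    algebraize [τ.toRingHom]
    exact Polynomial.isIntegral_coeff_of_dvd q _ hqm hmon hdvd i
  have hint' : IsIntegral K[X] (RatFunc.Luroth.generator E) := by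
    obtain ⟨r, hrm, hr⟩ := hint
    refine ⟨r.map (aeval p : K[X] →ₐ[K] K[X]).toRingHom, hrm.map _, ?_⟩
    rw [eval₂_map, ← hτ, hi]
    change eval₂ _ (algebraMap E (RatFunc K) _) r = 0
    rw [← hom_eval₂, hr, map_zero]
  exact IsIntegrallyClosed.isIntegral_iff.mp hint'

/-- `K(u) ∩ K[X] = K[u]` for a polynomial `u`. -/
theorem mem_adjoin_polynomial {K : Type*} [Field K] (u q : K[X])
    (hq : algebraMap K[X] (RatFunc K) q ∈
      IntermediateField.adjoin K {algebraMap K[X] (RatFunc K) u}) :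
    ∃ P : K[X], q = aeval u P := by
  obtain ⟨r, s, h⟩ := IntermediateField.mem_adjoin_simple_iff K _ |>.mp hq
  have hae : ∀ t : K[X], aeval (algebraMap K[X] (RatFunc K) u) t =
      algebraMap K[X] (RatFunc K) (aeval u t) := fun t => aeval_algebraMap_apply _ _ _
  rw [hae, hae] at h
  -- If the denominator vanishes, division by zero gives `q = 0`.
  by_cases hs : aeval u s = 0
  · refine ⟨0, ?_⟩
    rw [hs, map_zero, div_zero] at h
    rw [map_zero]
    exact (map_eq_zero_iff _ (RatFunc.algebraMap_injective K)).mp h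
  have h' : q * aeval u s = aeval u r := by
    apply RatFunc.algebraMap_injective K
    rw [map_mul, h, div_mul_cancel₀]
    exact (map_ne_zero_iff _ (RatFunc.algebraMap_injective K)).mpr hs
  have hs0 : s ≠ 0 := by rintro rfl; simp at hs
  classical
  obtain ⟨g, r', s', hco, hr, hsg⟩ : ∃ g r' s' : K[X], IsCoprime r' s' ∧ r = g * r' ∧ s = g * s' := by
    obtain ⟨r', hr'⟩ := EuclideanDomain.gcd_dvd_left r s
    obtain ⟨s', hs'⟩ := EuclideanDomain.gcd_dvd_right r s
    refine ⟨_, r', s', ?_, hr', hs'⟩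
    have hg : EuclideanDomain.gcd r s ≠ 0 := fun h => hs0 (EuclideanDomain.gcd_eq_zero_iff.mp h).2
    refine ⟨EuclideanDomain.gcdA r s, EuclideanDomain.gcdB r s, mul_left_cancel₀ hg ?_⟩
    have := EuclideanDomain.gcd_eq_gcd_ab r s
    linear_combination (-1 : K[X]) * this - EuclideanDomain.gcdA r s * hr' -
      EuclideanDomain.gcdB r s * hs'
  rw [hsg, map_mul] at hs
  have hg0 : aeval u g ≠ 0 := left_ne_zero_of_mul hs
  have h2 : q * aeval u s' = aeval u r' := by
    apply mul_left_cancel₀ hg0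
    rw [hr, hsg, map_mul, map_mul] at h'
    linear_combination h'
  obtain ⟨a, b, hab⟩ := hco
  have hab' := congrArg (aeval u) hab
  rw [map_add, map_mul, map_mul, map_one, ← h2] at hab'
  -- Bézout at `u` makes the reduced denominator a unit of `K[X]`, so a constant.
  have hunit : aeval u s' * (aeval u a * q + aeval u b) = 1 := by
    rw [← hab']; ring
  obtain ⟨c, hc, hcs⟩ := Polynomial.isUnit_iff.mp (IsUnit.of_mul_eq_one _ hunit)
  refine ⟨C c⁻¹ * r', ?_⟩
  rw [map_mul, ← h2, ← hcs, aeval_C, algebraMap_eq, mul_left_comm, ← C_mul,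
    inv_mul_cancel₀ hc.ne_zero, C_1, mul_one]

/-! ### The integral closure of `ℂ[f]` -/

/-- A nonconstant polynomial is nonconstant on some line. -/
theorem exists_line_restriction (f : PlaneRing) (hf : IsNonconstant f) :
    ∃ φ : PlaneRing →ₐ[ℂ] ℂ[X], 0 < (φ f).natDegree := by
  obtain ⟨a, ha⟩ : ∃ a : Fin 2 → ℂ, MvPolynomial.eval a f ≠ MvPolynomial.eval 0 f := by
    by_contra! h
    refine hf (MvPolynomial.eval 0 f) (MvPolynomial.funext fun a => ?_)
    rw [h, MvPolynomial.eval_C]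
  refine ⟨MvPolynomial.aeval fun i => C (a i) * X, Nat.pos_of_ne_zero fun h => ha ?_⟩
  have key : ∀ t : ℂ, ((MvPolynomial.aeval fun i => C (a i) * X) f : ℂ[X]).eval t =
      MvPolynomial.eval (fun i => a i * t) f := fun t => by
    have : ((aeval t : ℂ[X] →ₐ[ℂ] ℂ).comp (MvPolynomial.aeval fun i => C (a i) * X)) =
        MvPolynomial.aeval (fun i => a i * t) := by
      ext i; simp
    simpa [MvPolynomial.aeval_eq_eval] using DFunLike.congr_fun this f
  have h1 := key 1
  have h0 := key 0
  rw [eq_C_of_natDegree_eq_zero h, eval_C] at h0 h1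
  simp only [mul_one, mul_zero] at h0 h1
  exact h1.symm.trans h0

/-- An integrally closed `K`-subalgebra of `K[X]` containing a nonconstant polynomial is generated
by one element. -/
theorem exists_generator_of_injective {K A : Type*} [Field K] [CommRing A] [IsDomain A]
    [IsIntegrallyClosed A] [Algebra K A] (σ : A →ₐ[K] K[X]) (hinj : Function.Injective σ)
    (a : A) (ha : 0 < (σ a).natDegree) : ∃ j₀ : A, ∀ j : A, ∃ P : K[X], j = aeval j₀ P := by
  let ψ : A →ₐ[K] RatFunc K := ((Algebra.ofId K[X] (RatFunc K)).restrictScalars K).comp σ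
  have hψinj : Function.Injective ψ := (RatFunc.algebraMap_injective K).comp hinj
  let E := IntermediateField.adjoin K (ψ.range : Set (RatFunc K))
  have hE : ∀ a, ψ a ∈ E := fun a => IntermediateField.subset_adjoin _ _ ⟨a, rfl⟩
  obtain ⟨u, hu⟩ := exists_polynomial_generator E (σ a) ha (hE a)
  have huE : algebraMap K[X] (RatFunc K) u ∈ E := by
    rw [hu]; exact IntermediateField.mem_adjoin_simple_self _ _
  -- `u` is a quotient of elements of `A` and is integral over `A`, which is integrally closed.
  obtain ⟨j₀, hj₀⟩ : ∃ a : A, σ a = u := by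
    obtain ⟨r, hr, s, hs, hrs⟩ := IntermediateField.mem_adjoin_iff_div.mp huE
    rw [Algebra.adjoin_eq] at hr hs
    obtain ⟨r, rfl⟩ := hr
    obtain ⟨s, rfl⟩ := hs
    let _ := ψ.toRingHom.toAlgebra
    have : FaithfulSMul A (RatFunc K) := (faithfulSMul_iff_algebraMap_injective _ _).mpr hψinj
    let _ := FractionRing.liftAlgebra A (RatFunc K)
    have hx : algebraMap (FractionRing A) (RatFunc K)
        (algebraMap A _ r / algebraMap A _ s) = algebraMap K[X] (RatFunc K) u := by
      rw [map_div₀, ← IsScalarTower.algebraMap_apply, ← IsScalarTower.algebraMap_apply]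
      exact hrs.symm
    have hint : IsIntegral A (algebraMap (FractionRing A) (RatFunc K)
        (algebraMap A _ r / algebraMap A _ s)) := by
      rw [hx]
      obtain ⟨q, hqm, hq⟩ := isIntegral_polynomial_of_natDegree_pos σ a ha u
      refine ⟨q, hqm, ?_⟩
      change eval₂ ((algebraMap K[X] (RatFunc K)).comp σ.toRingHom) _ q = 0
      rw [← hom_eval₂, hq, map_zero]
    rw [isIntegral_algebraMap_iff (FaithfulSMul.algebraMap_injective _ _)] at hint
    obtain ⟨b, hb⟩ := IsIntegrallyClosed.isIntegral_iff.mp hint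
    refine ⟨b, RatFunc.algebraMap_injective K ?_⟩
    rw [← hx, ← hb, ← IsScalarTower.algebraMap_apply]
    rfl
  refine ⟨j₀, fun j => ?_⟩
  obtain ⟨P, hP⟩ := mem_adjoin_polynomial u (σ j) (hu ▸ hE j)
  exact ⟨P, hinj (by rw [hP, ← hj₀, aeval_algHom_apply])⟩

/-- A `K`-algebra map that does not send `f` to a constant is injective on the integral closure of
`K[f]`. -/
theorem injective_of_isIntegral_adjoin {K R : Type*} [Field K] [CommRing R] [IsDomain R]
    [Algebra K R] (f : R) (φ : R →ₐ[K] K[X]) (hφ : 0 < (φ f).natDegree) (x : R)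
    (hx : IsIntegral (Algebra.adjoin K {f}) x) (h : φ x = 0) : x = 0 := by
  by_contra h0
  -- In a domain, an ideal with a nonzero integral element meets the base ring nontrivially; here
  -- this gives `P ≠ 0` with `P(φ f) = 0`.
  have : (RingHom.ker φ).comap (algebraMap (Algebra.adjoin K {f}) R) ≠ ⊥ :=
    Ideal.comap_ne_bot_of_integral_mem h0 h hx
  obtain ⟨⟨s, hs⟩, hsker, hs0⟩ := Submodule.exists_mem_ne_zero_of_ne_bot this
  rw [Algebra.adjoin_singleton_eq_range_aeval] at hs
  obtain ⟨P, rfl⟩ := hs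
  have h1 : φ (aeval f P) = 0 := hsker
  rw [← aeval_algHom_apply] at h1
  have hP : P = 0 := by
    by_contra hP
    rw [aeval_def, algebraMap_eq] at h1
    exact hP ((comp_eq_zero_iff.mp h1).resolve_right fun h => by
      rw [h.2, natDegree_C] at hφ; exact hφ.false)
  subst hP
  exact hs0 (Subtype.ext (map_zero (aeval f)))

theorem isIntegrallyClosed_integralClosure (S R : Type*) [CommRing S] [CommRing R] [IsDomain R]
    [IsIntegrallyClosed R] [Algebra S R] : IsIntegrallyClosed (integralClosure S R) :=
  .of_isIntegrallyClosed_of_isIntegrallyClosedIn _ R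

/-- The integral closure of `ℂ[f]` in `ℂ[x, y]` is generated by one polynomial. -/
theorem exists_generator_integralClosure (f : PlaneRing) (hf : IsNonconstant f) :
    ∃ j₀ : PlaneRing, ∀ j : PlaneRing, IsIntegral (Algebra.adjoin ℂ {f}) j →
      ∃ P : ℂ[X], j = aeval j₀ P := by
  obtain ⟨φ, hφ⟩ := exists_line_restriction f hf
  have hf' : f ∈ integralClosure (Algebra.adjoin ℂ {f}) PlaneRing :=
    isIntegral_algebraMap (x := (⟨f, Algebra.self_mem_adjoin_singleton ℂ f⟩ :
      Algebra.adjoin ℂ {f}))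
  let A := (integralClosure (Algebra.adjoin ℂ {f}) PlaneRing).restrictScalars ℂ
  have : IsIntegrallyClosed A :=
    isIntegrallyClosed_integralClosure (Algebra.adjoin ℂ {f}) PlaneRing
  obtain ⟨j₀, h⟩ := exists_generator_of_injective (φ.comp A.val)
    ((injective_iff_map_eq_zero _).mpr fun x hx => Subtype.ext
      (injective_of_isIntegral_adjoin f φ hφ x x.2 hx)) ⟨f, hf'⟩ hφ
  refine ⟨j₀, fun j hj => ?_⟩
  obtain ⟨P, hP⟩ := h ⟨j, hj⟩
  refine ⟨P, ?_⟩
  have := congrArg A.val hP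
  rwa [← aeval_algHom_apply] at this

/-! ### Universal and deepest factorizations -/

theorem substPoly_comp (α i : ℂ[X]) (W : PlaneRing) :
    substPoly (α.comp i) W = substPoly α (substPoly i W) :=
  aeval_comp W

theorem substPoly_X (W : PlaneRing) : substPoly X W = W := aeval_X W

theorem substPoly_linear (a c : ℂ) (W : PlaneRing) :
    substPoly (C a * X + C c) W = MvPolynomial.C a * W + MvPolynomial.C c := by
  simp [substPoly, MvPolynomial.algebraMap_eq]

theorem inv_linear_comp_linear {a : ℂ} (ha : a ≠ 0) (c : ℂ) :
    (C a⁻¹ * X + C (-(a⁻¹ * c))).comp (C a * X + C c) = (X : ℂ[X]) := by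
  have h : C a⁻¹ * C a = (1 : ℂ[X]) := by rw [← C_mul, inv_mul_cancel₀ ha, C_1]
  simp only [add_comp, mul_comp, C_comp, X_comp, C_mul, C_neg, neg_comp]
  linear_combination X * h

theorem linear_comp_inv_linear {a : ℂ} (ha : a ≠ 0) (c : ℂ) :
    (C a * X + C c).comp (C a⁻¹ * X + C (-(a⁻¹ * c))) = (X : ℂ[X]) := by
  have h : C a⁻¹ * C a = (1 : ℂ[X]) := by rw [← C_mul, inv_mul_cancel₀ ha, C_1]
  simp only [add_comp, mul_comp, C_comp, X_comp, C_mul, C_neg]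
  linear_combination (X - C c) * h

namespace LineFactorization

variable {f : PlaneRing}

theorem depth_pos (hf : IsNonconstant f) (F : LineFactorization f) : 0 < F.depth := by
  refine Nat.pos_of_ne_zero fun h => hf (F.outer.coeff 0) ?_
  refine F.fac.trans ?_
  rw [substPoly, eq_C_of_natDegree_eq_zero h, aeval_C, coeff_C_zero, MvPolynomial.algebraMap_eq]

theorem substPoly_injective (hf : IsNonconstant f) (F : LineFactorization f) :
    Function.Injective fun p => substPoly p F.inner := by
  obtain ⟨φ, hφ⟩ := exists_line_restriction f hf
  have hj : (φ F.inner).natDegree ≠ 0 := fun h => by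
    rw [show φ f = φ (aeval F.inner F.outer) from congrArg φ F.fac, ← aeval_algHom_apply, aeval_def,
      algebraMap_eq] at hφ
    change 0 < (F.outer.comp (φ F.inner)).natDegree at hφ
    rw [natDegree_comp, h, mul_zero] at hφ
    exact hφ.false
  intro p q h
  have h1 : φ (aeval F.inner p) = φ (aeval F.inner q) := congrArg φ h
  rw [← aeval_algHom_apply, ← aeval_algHom_apply, ← sub_eq_zero, ← map_sub, aeval_def,
    algebraMap_eq] at h1
  exact sub_eq_zero.mp ((comp_eq_zero_iff.mp h1).resolve_right fun h => hj (by
    rw [h.2, natDegree_C]))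

/-- Since `p ↦ p(j)` is injective, the condition on inner parts alone decides universality. -/
theorem outer_eq_comp (hf : IsNonconstant f) (F G : LineFactorization f) (i : ℂ[X])
    (h : G.inner = substPoly i F.inner) : F.outer = G.outer.comp i :=
  F.substPoly_injective hf (by
    change substPoly _ _ = substPoly _ _
    rw [substPoly_comp, ← h, ← F.fac, ← G.fac])

theorem exists_isUniversal (hf : IsNonconstant f) : ∃ F : LineFactorization f, F.IsUniversal := by
  obtain ⟨j₀, hj₀⟩ := exists_generator_integralClosure f hf
  have hfint : IsIntegral (Algebra.adjoin ℂ {f}) f := isIntegral_algebraMap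
    (x := (⟨f, Algebra.self_mem_adjoin_singleton ℂ f⟩ : Algebra.adjoin ℂ {f}))
  obtain ⟨α₀, hα₀⟩ := hj₀ f hfint
  refine ⟨⟨α₀, j₀, hα₀⟩, fun G => ?_⟩
  obtain ⟨i, hi⟩ := hj₀ G.inner (.of_aeval_natDegree_pos G.outer (G.depth_pos hf) _ (by
    have := G.fac
    rw [substPoly] at this
    rwa [← this]))
  exact ⟨i, outer_eq_comp hf ⟨α₀, j₀, hα₀⟩ G i hi, hi⟩

/-- The factorization `(α ∘ i, i⁻¹ ∘ j)`. -/
noncomputable def changeCoord (F : LineFactorization f) (i i' : ℂ[X]) (h : i.comp i' = X) :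
    LineFactorization f where
  outer := F.outer.comp i
  inner := substPoly i' F.inner
  fac := by rw [substPoly_comp, ← substPoly_comp i, h, substPoly_X, ← F.fac]

theorem IsUniversal.of_comp (hf : IsNonconstant f) {F G : LineFactorization f}
    (hF : F.IsUniversal) (i : ℂ[X]) (h : F.inner = substPoly i G.inner) : G.IsUniversal := by
  intro H
  obtain ⟨k, -, hk⟩ := hF H
  have : H.inner = substPoly (k.comp i) G.inner := by rw [substPoly_comp, ← h, hk]
  exact ⟨_, outer_eq_comp hf G H _ this, this⟩

theorem IsUniversal.equivalent (hf : IsNonconstant f) {F G : LineFactorization f}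
    (hF : F.IsUniversal) (hG : G.IsUniversal) : F.Equivalent G := by
  obtain ⟨i, -, hi⟩ := hF G
  obtain ⟨k, hk', hk⟩ := hG F
  refine ⟨k, ⟨i, F.substPoly_injective hf ?_, G.substPoly_injective hf ?_⟩, hk', hk⟩
  · change substPoly _ _ = substPoly _ _
    rw [substPoly_comp, ← hi, ← hk, substPoly_X]
  · change substPoly _ _ = substPoly _ _
    rw [substPoly_comp, ← hk, ← hi, substPoly_X]

theorem IsUniversal.isDeepest (hf : IsNonconstant f) {F : LineFactorization f}
    (hF : F.IsUniversal) : F.IsDeepest := by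
  intro G
  obtain ⟨i, hi, -⟩ := hF G
  have := F.depth_pos hf
  unfold depth at *
  rw [hi, natDegree_comp] at this ⊢
  exact Nat.le_mul_of_pos_right _ (Nat.pos_of_mul_pos_left this)

/-- Comparison with a universal factorization gives a connecting `i` of degree 1, hence invertible.
-/
theorem IsDeepest.isUniversal (hf : IsNonconstant f) {F : LineFactorization f}
    (hF : F.IsDeepest) : F.IsUniversal := by
  obtain ⟨U, hU⟩ := exists_isUniversal hf
  obtain ⟨i, hi, hi'⟩ := hU F
  have h1 : i.natDegree = 1 := by
    have h := hF U
    have hpos := U.depth_pos hf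
    have hpos' := F.depth_pos hf
    unfold depth at *
    rw [hi, natDegree_comp] at h hpos
    have h2 := Nat.le_of_mul_le_mul_left (h.trans_eq (mul_one _).symm) hpos'
    have h3 := Nat.pos_of_mul_pos_left hpos
    omega
  obtain ⟨a, ha, c, rfl⟩ := natDegree_eq_one.mp h1
  refine hU.of_comp hf (C a⁻¹ * X + C (-(a⁻¹ * c))) ?_
  rw [hi', ← substPoly_comp]
  rw [inv_linear_comp_linear ha, substPoly_X]

end LineFactorization

/-! ### Tschirnhausen normal form and principal polynomials -/

theorem coeff_comp_linear (p : ℂ[X]) (a c : ℂ) {n : ℕ} (hn : p.natDegree = n + 1) :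
    (p.comp (C a * X + C c)).coeff n = (p.coeff n + (n + 1) * c * p.coeff (n + 1)) * a ^ n := by
  have : p.comp (C a * X + C c) = (taylor c p).comp (C a * X) := by
    rw [taylor_apply, comp_assoc]; simp
  rw [this, comp_C_mul_X_coeff, taylor_coeff]
  congr 1
  have hd : (hasseDeriv n p).natDegree < 2 := by
    have := natDegree_hasseDeriv_le p n
    omega
  rw [eval_eq_sum_range' hd]
  simp only [Finset.sum_range_succ, Finset.sum_range_zero, hasseDeriv_coeff, zero_add,
    Nat.choose_self, add_comm 1 n, Nat.choose_succ_self_right]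
  push_cast
  ring

theorem coeff_comp_linear_top (p : ℂ[X]) {a : ℂ} (ha : a ≠ 0) (c : ℂ) :
    (p.comp (C a * X + C c)).natDegree = p.natDegree ∧
    (p.comp (C a * X + C c)).leadingCoeff = p.leadingCoeff * a ^ p.natDegree := by
  constructor
  · rw [natDegree_comp, natDegree_linear ha, mul_one]
  · rw [leadingCoeff_comp (by rw [natDegree_linear ha]; exact one_ne_zero), leadingCoeff_linear ha]

/-- Every nonconstant polynomial becomes Tschirnhausen after a linear substitution. -/
theorem exists_comp_mem_tschirnhausen (p : ℂ[X]) (hp : 0 < p.natDegree) :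
    ∃ a c : ℂ, a ≠ 0 ∧ p.comp (C a * X + C c) ∈ tschirnhausen := by
  obtain ⟨n, hn⟩ := Nat.exists_eq_add_one_of_ne_zero hp.ne'
  have hl : p.leadingCoeff ≠ 0 := by
    rw [Ne, leadingCoeff_eq_zero]
    rintro rfl
    simp at hp
  obtain ⟨a, ha⟩ := IsAlgClosed.exists_pow_nat_eq p.leadingCoeff⁻¹ hp
  have ha0 : a ≠ 0 := by
    rintro rfl
    rw [zero_pow hp.ne'] at ha
    exact inv_ne_zero hl ha.symm
  have hn0 : (n : ℂ) + 1 ≠ 0 := Nat.cast_add_one_ne_zero n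
  -- `a` normalizes the leading coefficient; the shift kills the next one.
  refine ⟨a, -(p.coeff n / ((n + 1) * p.leadingCoeff)), ha0, ?_, ?_, ?_⟩
  · rw [Monic, (coeff_comp_linear_top p ha0 _).2, ha, mul_inv_cancel₀ hl]
  · rwa [(coeff_comp_linear_top p ha0 _).1]
  · rw [(coeff_comp_linear_top p ha0 _).1, hn, Nat.add_sub_cancel, coeff_comp_linear p _ _ hn,
      ← hn, coeff_natDegree]
    field_simp
    ring

/-- Two Tschirnhausen polynomials differ by a linear substitution only if that is the
multiplication by a root of unity. -/
theorem eq_zero_and_pow_eq_one_of_comp_mem_tschirnhausen {p : ℂ[X]} (hp : p ∈ tschirnhausen)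
    {a c : ℂ} (ha : a ≠ 0) (h : p.comp (C a * X + C c) ∈ tschirnhausen) :
    c = 0 ∧ a ^ p.natDegree = 1 := by
  obtain ⟨hm, hpos, hc⟩ := hp
  obtain ⟨hm', -, hc'⟩ := h
  obtain ⟨n, hn⟩ := Nat.exists_eq_add_one_of_ne_zero hpos.ne'
  rw [Monic, (coeff_comp_linear_top p ha _).2, hm.leadingCoeff, one_mul] at hm'
  rw [hn, Nat.add_sub_cancel] at hc
  rw [(coeff_comp_linear_top p ha _).1, hn, Nat.add_sub_cancel, coeff_comp_linear p _ _ hn, hc,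
    ← hn, hm.coeff_natDegree] at hc'
  refine ⟨?_, hm'⟩
  have hn0 : (n : ℂ) + 1 ≠ 0 := Nat.cast_add_one_ne_zero n
  simpa [ha, hn0] using hc'

theorem comp_mem_tschirnhausen {p : ℂ[X]} (hp : p ∈ tschirnhausen) {a : ℂ}
    (ha : a ^ p.natDegree = 1) : p.comp (C a * X) ∈ tschirnhausen := by
  obtain ⟨hm, hpos, hc⟩ := hp
  have ha0 : a ≠ 0 := by
    rintro rfl
    rw [zero_pow hpos.ne'] at ha
    exact zero_ne_one ha
  have h := coeff_comp_linear_top p ha0 0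
  rw [C_0, add_zero] at h
  refine ⟨?_, ?_, ?_⟩
  · rw [Monic, h.2, ha, hm.leadingCoeff, one_mul]
  · rwa [h.1]
  · rw [h.1, comp_C_mul_X_coeff, hc, zero_mul]

theorem X_mem_tschirnhausen : (X : ℂ[X]) ∈ tschirnhausen :=
  ⟨monic_X, by rw [natDegree_X]; exact one_pos, by simp⟩

theorem eq_X_of_mem_tschirnhausen {p : ℂ[X]} (hp : p ∈ tschirnhausen) (h : p.natDegree ≤ 1) :
    p = X := by
  obtain ⟨hm, hpos, hc⟩ := hp
  have h1 : p.natDegree = 1 := le_antisymm h hpos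
  rw [h1] at hc
  rw [hm.eq_X_add_C h1, hc, C_0, add_zero]

theorem LineFactorization.IsUniversal.isPrincipalPoly {f : PlaneRing} (hf : IsNonconstant f)
    {F : LineFactorization f} (hF : F.IsUniversal) : IsPrincipalPoly F.inner := by
  refine Set.eq_singleton_iff_unique_mem.mpr ⟨⟨X, X_mem_tschirnhausen, (substPoly_X _).symm⟩, ?_⟩
  rintro W ⟨β, hβ, hW⟩
  have h := hF.isDeepest hf ⟨F.outer.comp β, W, by rw [substPoly_comp, ← hW, ← F.fac]⟩
  have hpos := F.depth_pos hf
  unfold depth at h hpos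
  rw [natDegree_comp] at h
  have hX := eq_X_of_mem_tschirnhausen hβ
    (Nat.le_of_mul_le_mul_left (h.trans_eq (mul_one _).symm) hpos)
  rw [hW, hX, substPoly_X]

theorem mainTheorem8 (f : PlaneRing) (hf : IsNonconstant f) :
    -- a universal factorization exists, and it is unique up to equivalence
    (∃ F : LineFactorization f, F.IsUniversal) ∧
    (∀ F₁ F₂ : LineFactorization f, F₁.IsUniversal → F₂.IsUniversal → F₁.Equivalent F₂) ∧
    -- universal is the same as deepest
    (∀ F : LineFactorization f, F.IsUniversal ↔ F.IsDeepest) ∧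
    -- the principal polynomials in `𝒲(f)` are exactly the multiples of one of them, `W₀`,
    -- by `k`-th roots of unity, where `k` is the depth of a universal factorization
    (∃ F : LineFactorization f, F.IsUniversal ∧ F.outer ∈ tschirnhausen ∧
      F.inner ∈ tschirnhausenRoots f ∧ IsPrincipalPoly F.inner ∧
      ∀ W : PlaneRing, (W ∈ tschirnhausenRoots f ∧ IsPrincipalPoly W) ↔
        ∃ ζ : ℂ, ζ ^ F.depth = 1 ∧ W = MvPolynomial.C ζ * F.inner) := by
  refine ⟨LineFactorization.exists_isUniversal hf, fun _ _ h₁ h₂ => h₁.equivalent hf h₂,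
    fun F => ⟨fun h => h.isDeepest hf, fun h => h.isUniversal hf⟩, ?_⟩
  obtain ⟨U, hU⟩ := LineFactorization.exists_isUniversal hf
  obtain ⟨a, c, ha, hac⟩ := exists_comp_mem_tschirnhausen U.outer (U.depth_pos hf)
  obtain ⟨F, hFo, hFi⟩ : ∃ F : LineFactorization f, F.outer = U.outer.comp (C a * X + C c) ∧
      U.inner = substPoly (C a * X + C c) F.inner := by
    have h1 : (C a * X + C c).comp (C a⁻¹ * X + C (-(a⁻¹ * c))) = (X : ℂ[X]) :=
      linear_comp_inv_linear ha c
    refine ⟨U.changeCoord _ _ h1, rfl, ?_⟩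
    rw [LineFactorization.changeCoord, ← substPoly_comp, h1, substPoly_X]
  have hF : F.IsUniversal := hU.of_comp hf _ hFi
  have hFT : F.outer ∈ tschirnhausen := hFo ▸ hac
  refine ⟨F, hF, hFT, ⟨F.outer, hFT, F.fac⟩, hF.isPrincipalPoly hf, fun W => ⟨?_, ?_⟩⟩
  · rintro ⟨⟨α, hα, hW⟩, hWp⟩
    obtain ⟨i, hi, hi'⟩ := hF ⟨α, W, hW⟩
    change W = _ at hi'
    have hipos : 0 < i.natDegree := by
      have := F.depth_pos hf
      unfold LineFactorization.depth at this
      rw [hi, natDegree_comp] at this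
      exact Nat.pos_of_mul_pos_left this
    -- `i` need not be Tschirnhausen. Once normalized, it exhibits a linear image of `F.inner` in
    -- `𝒲(W)`, which must equal `W` by principality.
    obtain ⟨b, d, hb, hbd⟩ := exists_comp_mem_tschirnhausen i hipos
    have h1 : (C b * X + C d).comp (C b⁻¹ * X + C (-(b⁻¹ * d))) = (X : ℂ[X]) :=
      linear_comp_inv_linear hb d
    have hmem : substPoly (C b⁻¹ * X + C (-(b⁻¹ * d))) F.inner ∈ tschirnhausenRoots W :=
      ⟨_, hbd, by rw [substPoly_comp, ← substPoly_comp (C b * X + C d), h1, substPoly_X, hi']⟩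
    rw [hWp, Set.mem_singleton_iff] at hmem
    have hout := LineFactorization.outer_eq_comp hf F ⟨α, W, hW⟩ _ hmem.symm
    change _ = α.comp _ at hout
    obtain ⟨hz, hone⟩ := eq_zero_and_pow_eq_one_of_comp_mem_tschirnhausen hα (inv_ne_zero hb)
      (hout ▸ hFT)
    refine ⟨b⁻¹, ?_, ?_⟩
    · rw [LineFactorization.depth, hout, (coeff_comp_linear_top α (inv_ne_zero hb) _).1, hone]
    · rw [← hmem, substPoly_linear, hz, MvPolynomial.C_0, add_zero]
  · rintro ⟨ζ, hζ, rfl⟩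
    have hζ0 : ζ ≠ 0 := by
      rintro rfl
      rw [zero_pow (F.depth_pos hf).ne'] at hζ
      exact zero_ne_one hζ
    have h1 : (C ζ⁻¹ * X).comp (C ζ * X) = (X : ℂ[X]) := by
      simp only [mul_comp, C_comp, X_comp, ← mul_assoc, ← C_mul, inv_mul_cancel₀ hζ0, C_1, one_mul]
    have hin : substPoly (C ζ * X) F.inner = MvPolynomial.C ζ * F.inner := by
      simpa using substPoly_linear ζ 0 F.inner
    rw [← hin]
    have hG : (F.changeCoord _ _ h1).IsUniversal := hF.of_comp hf (C ζ⁻¹ * X) (by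
      rw [LineFactorization.changeCoord, ← substPoly_comp, h1, substPoly_X])
    refine ⟨⟨_, comp_mem_tschirnhausen hFT (a := ζ⁻¹) ?_, (F.changeCoord _ _ h1).fac⟩,
      hG.isPrincipalPoly hf⟩
    rw [inv_pow, show ζ ^ F.outer.natDegree = 1 from hζ, inv_one]
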